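/- Let $A,B,C,D$ be finite-dimensional quantum systems and let $\rho=\rho_{ABCD}$ be any density matrix (positive semidefinite, unit trace, not necessarily of full rank) on $\mathcal H_A\otimes\mathcal H_B\otimes\mathcal H_C\otimes\mathcal H_D$; denote its marginals by $\rho_{AB},\rho_{BC},\rho_B$, etc. For $\lambda\in\mathbb R$ and disjoint groups of subsystems $R,S$, let the twirled Petz map be $$\mathcal P^{(\lambda)}_{R\to RS}(X)=\rho_{RS}^{\frac12-\frac{i\lambda}2}\Big(\big(\rho_R^{-\frac12+\frac{i\lambda}2}\,X\,\rho_R^{-\frac12-\frac{i\lambda}2}\big)\otimes \mathbf 1_S\Big)\rho_{RS}^{\frac12+\frac{i\lambda}2},$$ where complex powers of positive semidefinite matrices are taken on their supports and are zero on their kernels. Define the two-step recovered operator $$\tilde\rho^{(2,\lambda)}_{ABCD}=\big(\mathrm{id}_{AB}\otimes\mathcal P^{(\lambda)}_{C\to CD}\big)\Big(\big(\mathrm{id}_A\otimes\mathcal P^{(\lambda)}_{B\to BC}\big)(\rho_{AB})\Big),$$ with the same $\lambda$ in both steps and both maps built from the marginals of the original state $\rho_{ABCD}$. Let $F(\rho,\sigma)=\|\sqrt\rho\sqrt\sigma\|_1$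 with $\|X\|_1=\mathrm{Tr}\,(X^\dagger X)^{1/2}$, let $S(\rho)=-\mathrm{Tr}\,\rho\log\rho$ (natural logarithm), and let $I(X:Z|Y)=S(\rho_{XY})+S(\rho_{YZ})-S(\rho_Y)-S(\rho_{XYZ})$. Then there is a $\lambda\in\mathbb R$ such that $$F\big(\rho_{ABCD},\tilde\rho^{(2,\lambda)}_{ABCD}\big)\ \ge\ \exp\!\Big(-\tfrac12\big[I(A:C|B)+I(B:D|C)+I(A:D|BC)\big]\Big).$$ In particular the supremum of the left-hand side over $\lambda$, and its maximum whenever it is attained, is at least the right-hand side. -/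

import Mathlib

open scoped Matrix Kronecker ComplexOrder

noncomputable section

namespace QRecovery

/-! ### States, partial traces and entropies

A system with a finite index type `m` is the Hilbert space `ℂ^m`; operators on it are matrices, and
the composite of the systems `m` and `n` is the system `m × n`. -/

/-- A state (density matrix): positive semidefinite with unit trace. -/
def IsState {m : Type*} [Fintype m] (ρ : Matrix m m ℂ) : Prop :=
  ρ.PosSemidef ∧ ρ.trace = 1

/-- The partial trace over the second factor. -/
def traceRight {m n : Type*} [Fintype n] (M : Matrix (m × n) (m × n) ℂ) : Matrix m m ℂ :=
  Matrix.of fun i j => ∑ k, M (i, k) (j, k)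

/-- The partial trace over the first factor. -/
def traceLeft {m n : Type*} [Fintype m] (M : Matrix (m × n) (m × n) ℂ) : Matrix n n ℂ :=
  Matrix.of fun i j => ∑ k, M (k, i) (k, j)

/-- Regrouping of an operator on `X(YZ)` as an operator on `(XY)Z`. -/
def regroup {X Y Z : Type*} (M : Matrix (X × Y × Z) (X × Y × Z) ℂ) :
    Matrix ((X × Y) × Z) ((X × Y) × Z) ℂ :=
  M.reindex (Equiv.prodAssoc X Y Z).symm (Equiv.prodAssoc X Y Z).symm

/-- Regrouping of an operator on `(XY)Z` as an operator on `X(YZ)`. -/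
def ungroup {X Y Z : Type*} (M : Matrix ((X × Y) × Z) ((X × Y) × Z) ℂ) :
    Matrix (X × Y × Z) (X × Y × Z) ℂ :=
  M.reindex (Equiv.prodAssoc X Y Z) (Equiv.prodAssoc X Y Z)

/-- The von Neumann entropy `S(ρ) = -Tr (ρ log ρ)` (natural logarithm, `0 log 0 = 0`). -/
def entropy {m : Type*} [Fintype m] [DecidableEq m] (ρ : Matrix m m ℂ) : ℝ :=
  (cfc Real.negMulLog ρ).trace.re

/-- The conditional mutual information of a tripartite state `ρ` on `XYZ`,
`I(X:Z|Y) = S(ρ_XY) + S(ρ_YZ) - S(ρ_Y) - S(ρ_XYZ)`. -/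
def condMutualInfo {X Y Z : Type*} [Fintype X] [Fintype Y] [Fintype Z]
    [DecidableEq X] [DecidableEq Y] [DecidableEq Z]
    (ρ : Matrix (X × Y × Z) (X × Y × Z) ℂ) : ℝ :=
  entropy (traceRight (regroup ρ)) + entropy (traceLeft ρ)
    - entropy (traceRight (traceLeft ρ)) - entropy ρ

/-! ### Fidelity -/

/-- The trace norm `‖X‖₁ = Tr ((X† X)^(1/2))`. -/
def traceNorm {m : Type*} [Fintype m] [DecidableEq m] (X : Matrix m m ℂ) : ℝ :=
  (cfc Real.sqrt (Xᴴ * X)).trace.re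

/-- The (unsquared) fidelity `F(ρ, σ) = ‖√ρ √σ‖₁`. -/
def fidelity {m : Type*} [Fintype m] [DecidableEq m] (ρ σ : Matrix m m ℂ) : ℝ :=
  traceNorm (cfc Real.sqrt ρ * cfc Real.sqrt σ)

/-! ### The twirled Petz map -/

open Classical in
/-- The complex power `M ^ z` of a positive semidefinite matrix, taken on the support of `M`: on the
eigenspace of an eigenvalue `x > 0` it is multiplication by `x ^ z`, on the kernel of `M` it is zero
(in particular negative powers are generalized inverses). For a matrix that is not Hermitian the
value is `0` by convention. -/
def cpow {m : Type*} [Fintype m] [DecidableEq m] (M : Matrix m m ℂ) (z : ℂ) : Matrix m m ℂ :=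
  if h : M.IsHermitian then
    (h.eigenvectorUnitary : Matrix m m ℂ) *
      Matrix.diagonal (fun i => if h.eigenvalues i = 0 then 0 else (h.eigenvalues i : ℂ) ^ z) *
      (h.eigenvectorUnitary : Matrix m m ℂ)ᴴ
  else 0

/-- The twirled Petz map `P^(t)_{R → RS}` of a bipartite operator `ρ_RS`, with `ρ_R = Tr_S ρ_RS`:
`X ↦ ρ_RS^(1/2 - it/2) ((ρ_R^(-1/2 + it/2) X ρ_R^(-1/2 - it/2)) ⊗ 1_S) ρ_RS^(1/2 + it/2)`. -/
def twirledPetz {R S : Type*} [Fintype R] [Fintype S] [DecidableEq R] [DecidableEq S]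
    (ρRS : Matrix (R × S) (R × S) ℂ) (t : ℝ) (X : Matrix R R ℂ) : Matrix (R × S) (R × S) ℂ :=
  cpow ρRS (1 / 2 - Complex.I * t / 2) *
    ((cpow (traceRight ρRS) (-1 / 2 + Complex.I * t / 2) * X *
      cpow (traceRight ρRS) (-1 / 2 - Complex.I * t / 2)) ⊗ₖ (1 : Matrix S S ℂ)) *
    cpow ρRS (1 / 2 + Complex.I * t / 2)

/-- The map `id_E ⊗ Φ` for a (linear) map `Φ` on operators:
`∑ |e⟩⟨e'| ⊗ Y_{e e'} ↦ ∑ |e⟩⟨e'| ⊗ Φ (Y_{e e'})`. -/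
def idTensor {E R T : Type*} (Φ : Matrix R R ℂ → Matrix T T ℂ)
    (Y : Matrix (E × R) (E × R) ℂ) : Matrix (E × T) (E × T) ℂ :=
  Matrix.of fun p q => Φ (Matrix.of fun r s => Y (p.1, r) (q.1, s)) p.2 q.2

/-! ### Marginals of a four-partite state and the two-step recovery -/

section FourPartite

variable {A B C D : Type*} [Fintype A] [Fintype B] [Fintype C] [Fintype D]

/-- The marginal on `AB`. -/
def margAB (ρ : Matrix (A × B × C × D) (A × B × C × D) ℂ) : Matrix (A × B) (A × B) ℂ :=
  traceRight (regroup ρ)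

/-- The marginal on `BC`. -/
def margBC (ρ : Matrix (A × B × C × D) (A × B × C × D) ℂ) : Matrix (B × C) (B × C) ℂ :=
  traceRight (regroup (traceLeft ρ))

/-- The marginal on `CD`. -/
def margCD (ρ : Matrix (A × B × C × D) (A × B × C × D) ℂ) : Matrix (C × D) (C × D) ℂ :=
  traceLeft (traceLeft ρ)

/-- The state on `A(BC)D`: the same operator, with `B` and `C` grouped into one system. -/
def groupBC (ρ : Matrix (A × B × C × D) (A × B × C × D) ℂ) :
    Matrix (A × (B × C) × D) (A × (B × C) × D) ℂ :=
  ρ.reindex ((Equiv.refl A).prodCongr (Equiv.prodAssoc B C D).symm)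
    ((Equiv.refl A).prodCongr (Equiv.prodAssoc B C D).symm)

/-- The marginal on `ABC`. -/
def margABC (ρ : Matrix (A × B × C × D) (A × B × C × D) ℂ) :
    Matrix (A × B × C) (A × B × C) ℂ :=
  traceRight (regroup (groupBC ρ))

/-- The marginal on `BCD`. -/
def margBCD (ρ : Matrix (A × B × C × D) (A × B × C × D) ℂ) :
    Matrix (B × C × D) (B × C × D) ℂ :=
  traceLeft ρ

variable [DecidableEq B] [DecidableEq C] [DecidableEq D]

/-- The output of the two-step recovery with parameter `t`: apply `P^(t)_{B → BC}` to `ρ_AB`, then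
`P^(t)_{C → CD}` to the resulting operator on `ABC`. Both maps are built from marginals of `ρ`. -/
def recovered (ρ : Matrix (A × B × C × D) (A × B × C × D) ℂ) (t : ℝ) :
    Matrix (A × B × C × D) (A × B × C × D) ℂ :=
  ungroup (idTensor (twirledPetz (margCD ρ) t)
    (regroup (idTensor (twirledPetz (margBC ρ) t) (margAB ρ))))

end FourPartite

end QRecovery

end

/-! Up to the sign of `λ`, the recovered operator is `K Kᴴ` at `z = 1 + it`, where `K(z) =
ρ_CD^(z/2) ρ_C^(-z/2) ρ_BC^(z/2) ρ_B^(-z/2) ρ_AB^(z/2)` is entire. Consider `f(z) = Tr (ρ · ρ^(-z/2)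
K(z))`. On `re z = 0` every factor is a contraction, so `|f| ≤ Tr ρ = 1`. At `0` the factors are
support projections that fix `ρ`, so `f 0 = 1`, and `f'(0)` is a signed sum of half entropies which
equals minus half the sum of the three conditional mutual informations (`sum_condMutualInfo`). On
`re z = 1`, cyclicity gives `f(1 + it) = Tr (√ρ K ρ^(-it/2))`, which trace norm duality
(`norm_trace_mul_le`) bounds by `‖√ρ K‖₁ = F(ρ, K Kᴴ)`. A derivative form of the three lines theorem
(`exists_exp_le_norm`) yields some `t` with `exp f'(0) ≤ |f(1 + it)|`. The value is attained because
a strict inequality along the whole right edge leaves room for a perturbation that contradicts the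
maximum principle at `0`. -/

namespace QRecovery

/-! ### A three lines estimate for the derivative at the boundary -/

lemma norm_mul_exp_sq_le {z : ℂ} (h0 : 0 ≤ z.re) (h1 : z.re ≤ 1) :
    ‖z * Complex.exp (z ^ 2)‖ * (1 + ‖z‖ ^ 2) ≤ Real.exp 2 * ‖z‖ := by
  have hre : (z ^ 2).re = 2 * z.re ^ 2 - ‖z‖ ^ 2 := by
    rw [Complex.sq_norm, Complex.normSq_apply, pow_two, Complex.mul_re]; ring
  rw [norm_mul, Complex.norm_exp, hre]
  have h2 : Real.exp (2 * z.re ^ 2 - ‖z‖ ^ 2) ≤ Real.exp 2 * Real.exp (-‖z‖ ^ 2) := by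
    rw [← Real.exp_add]
    exact Real.exp_le_exp.2 (by nlinarith)
  have h3 : Real.exp (-‖z‖ ^ 2) * (1 + ‖z‖ ^ 2) ≤ 1 := by
    have := Real.add_one_le_exp (‖z‖ ^ 2)
    calc _ ≤ Real.exp (-‖z‖ ^ 2) * Real.exp (‖z‖ ^ 2) := by gcongr; linarith
      _ = 1 := by rw [← Real.exp_add]; simp
  calc _ ≤ ‖z‖ * (Real.exp 2 * Real.exp (-‖z‖ ^ 2)) * (1 + ‖z‖ ^ 2) := by gcongr
    _ = Real.exp 2 * ‖z‖ * (Real.exp (-‖z‖ ^ 2) * (1 + ‖z‖ ^ 2)) := by ring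
    _ ≤ Real.exp 2 * ‖z‖ * 1 := by gcongr
    _ = _ := mul_one _

lemma re_mul_exp_sq_le {z : ℂ} (h0 : 0 ≤ z.re) (h1 : z.re ≤ 1) :
    (z * Complex.exp (z ^ 2)).re ≤ Real.exp 2 := by
  refine (Complex.re_le_norm _).trans ?_
  have h := norm_mul_exp_sq_le h0 h1
  have h2 : ‖z‖ ≤ 1 + ‖z‖ ^ 2 := by nlinarith [sq_nonneg (‖z‖ - 1), norm_nonneg z]
  have h3 : ‖z * Complex.exp (z ^ 2)‖ * (1 + ‖z‖ ^ 2) ≤ Real.exp 2 * (1 + ‖z‖ ^ 2) :=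
    h.trans (by gcongr)
  exact le_of_mul_le_mul_right h3 (by positivity)

/-- The threshold `2e²` makes `e²|z| ≤ |z|²/2`, which turns the Gaussian decay of
`norm_mul_exp_sq_le` into the bound `1/2`. -/
lemma re_mul_exp_sq_le_half {z : ℂ} (h0 : 0 ≤ z.re) (h1 : z.re ≤ 1)
    (h2 : 2 * Real.exp 2 ≤ |z.im|) : (z * Complex.exp (z ^ 2)).re ≤ 1 / 2 := by
  refine (Complex.re_le_norm _).trans ?_
  have h := norm_mul_exp_sq_le h0 h1
  have h3 := h2.trans (Complex.abs_im_le_norm z)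
  have h4 : Real.exp 2 * ‖z‖ ≤ 1 / 2 * (1 + ‖z‖ ^ 2) := by nlinarith [norm_nonneg z]
  exact le_of_mul_le_mul_right (h.trans h4) (by positivity)

/-- A boundary form of the three lines theorem: the logarithmic derivative at `0` of a function
bounded by `1` on the line `re z = 0` is dominated by an attained value on `re z = 1`. -/
theorem exists_exp_le_norm {f : ℂ → ℂ} {l K : ℝ} (hf : Differentiable ℂ f)
    (hK : ∀ z : ℂ, 0 ≤ z.re → z.re ≤ 1 → ‖f z‖ ≤ K)
    (h0 : ∀ z : ℂ, z.re = 0 → ‖f z‖ ≤ 1) (hf0 : f 0 = 1) (hd : HasDerivAt f (l : ℂ) 0) :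
    ∃ t : ℝ, Real.exp l ≤ ‖f (1 + t * Complex.I)‖ := by
  by_contra! h
  set T : ℝ := 2 * Real.exp 2 with hT
  have hTpos : 0 < T := by positivity
  have hcont : Continuous fun t : ℝ => ‖f (1 + t * Complex.I)‖ :=
    (hf.continuous.comp (by fun_prop)).norm
  obtain ⟨t₀, -, hmax⟩ := isCompact_Icc.exists_isMaxOn (s := Set.Icc (-T) T)
    ⟨0, by constructor <;> linarith⟩ hcont.continuousOn
  -- On `|t| ≤ T` compactness gives a uniform gap `M < exp l`. No such gap is available for large
  -- `|t|`, so the perturbation below has to help there.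
  set M := ‖f (1 + t₀ * Complex.I)‖ with hM
  obtain ⟨η, hη, hηpos⟩ : ∃ η : ℝ, M * Real.exp (η * Real.exp 2) < Real.exp l ∧ 0 < η := by
    have hc : Filter.Tendsto (fun η : ℝ => M * Real.exp (η * Real.exp 2)) (nhds 0) (nhds M) := by
      have : Continuous fun η : ℝ => M * Real.exp (η * Real.exp 2) := by fun_prop
      simpa using this.tendsto 0
    exact (((hc.eventually_lt_const (h t₀)).filter_mono nhdsWithin_le_nhds).and
      (self_mem_nhdsWithin : Set.Ioi (0 : ℝ) ∈ nhdsWithin 0 (Set.Ioi 0))).exists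
  -- `z exp(z²)` is imaginary on the left edge and has real part at most `1/2` far out on the right
  -- edge. There subtracting `z/2` makes the perturbation harmless, while near the real axis it
  -- costs at most `exp(η e²)`, which the gap absorbs. Its derivative at `0` is still `1 - 1/2 > 0`.
  set u : ℂ → ℂ := fun z => η * (z * Complex.exp (z ^ 2) - z / 2) - l * z with hu
  set g : ℂ → ℂ := fun z => f z * Complex.exp (u z) with hg
  have hure : ∀ z, (u z).re = η * ((z * Complex.exp (z ^ 2)).re - z.re / 2) - l * z.re := by
    intro z
    simp only [hu, Complex.sub_re, Complex.re_ofReal_mul]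
    norm_num
  have hgn : ∀ z, ‖g z‖ = ‖f z‖ * Real.exp (u z).re := by
    intro z; rw [hg]; simp only [norm_mul, Complex.norm_exp]
  have hgd : Differentiable ℂ g := by
    intro z
    simp only [hg, hu]
    have := hf z
    fun_prop
  have hle0 : ∀ z : ℂ, z.re = 0 → ‖g z‖ ≤ 1 := by
    intro z hz
    have h1 : (z * Complex.exp (z ^ 2)).re = 0 := by
      have : z = z.im * Complex.I := by apply Complex.ext <;> simp [hz]
      rw [this, mul_pow, Complex.I_sq]
      have : ((z.im : ℂ) ^ 2 * -1) = ((-z.im ^ 2 : ℝ) : ℂ) := by push_cast; ring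
      rw [this, ← Complex.ofReal_exp, mul_right_comm, ← Complex.ofReal_mul, Complex.re_ofReal_mul]
      simp
    rw [hgn, hure, h1, hz]
    simpa using h0 z hz
  have hle1 : ∀ z : ℂ, z.re = 1 → ‖g z‖ ≤ 1 := by
    intro z hz
    have hz' : z = 1 + z.im * Complex.I := by apply Complex.ext <;> simp [hz]
    rw [hgn, hure, hz, mul_one, Real.exp_sub, mul_div, div_le_one (Real.exp_pos _)]
    rcases le_total T |z.im| with h2 | h2
    · have h3 := re_mul_exp_sq_le_half (by simp [hz]) hz.le h2
      have h4 : Real.exp (η * ((z * Complex.exp (z ^ 2)).re - 1 / 2)) ≤ 1 :=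
        Real.exp_le_one_iff.2 (mul_nonpos_of_nonneg_of_nonpos hηpos.le (by linarith))
      have h5 := (h z.im).le
      rw [← hz'] at h5
      calc _ ≤ ‖f z‖ * 1 := by gcongr
        _ ≤ _ := by simpa using h5
    · have h3 := re_mul_exp_sq_le (z := z) (by simp [hz]) hz.le
      have h4 : ‖f z‖ ≤ M := by
        have := hmax (abs_le.1 h2)
        simp only [Set.mem_ofPred_eq] at this
        rwa [← hz'] at this
      calc _ ≤ M * Real.exp (η * Real.exp 2) := by gcongr; linarith
        _ ≤ _ := hη.le
  have hstrip : ∀ z : ℂ, 0 ≤ z.re → z.re ≤ 1 → ‖g z‖ ≤ 1 := by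
    intro z hz0 hz1
    refine PhragmenLindelof.vertical_strip (a := 0) (b := 1) hgd.diffContOnCl ?_ hle0 hle1 hz0 hz1
    -- `g` is bounded on the strip, so the growth condition holds with zero exponents.
    refine ⟨0, by simp [Real.pi_pos], 0, ?_⟩
    refine Asymptotics.IsBigO.of_bound (K * Real.exp (η * Real.exp 2 + |l|)) ?_
    refine Filter.mem_inf_of_right ?_
    intro z hz
    obtain ⟨hz0, hz1⟩ := hz
    simp only [Set.mem_ofPred_eq, zero_mul, Real.exp_zero, norm_one, mul_one]
    rw [hgn]
    have h1 := re_mul_exp_sq_le hz0.le hz1.le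
    have h2 : (u z).re ≤ η * Real.exp 2 + |l| := by
      rw [hure]
      have h3 : η * ((z * Complex.exp (z ^ 2)).re - z.re / 2) ≤ η * Real.exp 2 := by
        gcongr; linarith
      have h4 : -(l * z.re) ≤ |l| := by
        have := neg_abs_le l
        nlinarith [abs_nonneg l]
      linarith
    have h5 := hK z hz0.le hz1.le
    have h6 : 0 ≤ K := (norm_nonneg _).trans h5
    gcongr
  -- The term `-l` cancels `f'(0) = l`, leaving `η/2 > 0`. This contradicts `‖g‖ ≤ 1` to the right
  -- of `g 0 = 1`.
  have hgder : HasDerivAt g ((η / 2 : ℝ) : ℂ) 0 := by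
    have hu' : HasDerivAt u (η * (1 - 1 / 2) - l) 0 := by
      have h1 : HasDerivAt (fun z : ℂ => z * Complex.exp (z ^ 2)) 1 0 := by
        have := (hasDerivAt_id (0 : ℂ)).mul ((hasDerivAt_pow 2 (0 : ℂ)).cexp)
        simpa using! this
      have := ((h1.sub ((hasDerivAt_id (0 : ℂ)).div_const 2)).const_mul (η : ℂ)).sub
        ((hasDerivAt_id (0 : ℂ)).const_mul (l : ℂ))
      simpa using! this
    have := hd.mul hu'.cexp
    convert! this using 1
    simp [hu, hf0]; ring
  have hreal : HasDerivAt (fun x : ℝ => (g x).re) (η / 2) 0 := by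
    have := HasDerivAt.real_of_complex (z := 0) (by simpa using hgder)
    simpa using this
  have hslope := hreal.tendsto_slope_zero_right
  have hg0 : g 0 = 1 := by simp [hg, hu, hf0]
  have : η / 2 ≤ 0 := by
    refine le_of_tendsto hslope ?_
    filter_upwards [Ioo_mem_nhdsGT (zero_lt_one' ℝ)] with x hx
    have h1 := (Complex.re_le_norm _).trans (hstrip x (by simpa using hx.1.le) (by simpa using hx.2.le))
    simp only [zero_add, Complex.ofReal_zero, hg0, Complex.one_re, smul_eq_mul]
    exact mul_nonpos_of_nonneg_of_nonpos (inv_nonneg.2 hx.1.le) (by linarith)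
  linarith

/-! ### Complex powers on the support of a nonnegative vector -/

section PowVec

variable {m : Type*}

/-- The entrywise complex power, zero where the base vanishes. -/
noncomputable def powVec (x : m → ℝ) (z : ℂ) : m → ℂ :=
  fun i => if x i = 0 then 0 else (x i : ℂ) ^ z

lemma powVec_mul (x : m → ℝ) (z w : ℂ) : powVec x z * powVec x w = powVec x (z + w) := by
  ext i
  by_cases hi : x i = 0
  · simp [powVec, hi]
  · simp [powVec, hi, Complex.cpow_add]

lemma star_powVec {x : m → ℝ} (hx : ∀ i, 0 ≤ x i) (z : ℂ) :
    star (powVec x z) = powVec x (star z) := by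
  ext i
  by_cases hi : x i = 0
  · simp [powVec, hi]
  · have : (x i : ℂ).arg ≠ Real.pi := by
      rw [Complex.arg_ofReal_of_nonneg (hx i)]; exact Real.pi_pos.ne
    simp only [powVec, hi, Pi.star_apply, if_false]
    have h2 := Complex.cpow_conj (x i : ℂ) z this
    rw [Complex.conj_ofReal] at h2
    rw [Complex.star_def, h2]

lemma powVec_one (x : m → ℝ) : powVec x 1 = fun i => (x i : ℂ) := by
  ext i
  by_cases hi : x i = 0 <;> simp [powVec, hi]

lemma powVec_half {x : m → ℝ} (hx : ∀ i, 0 ≤ x i) :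
    powVec x (1 / 2) = fun i => (√(x i) : ℂ) := by
  ext i
  by_cases hi : x i = 0
  · simp [powVec, hi]
  · simp only [powVec, hi, if_false]
    rw [Real.sqrt_eq_rpow, Complex.ofReal_cpow (hx i)]
    norm_num

/-- A crude bound suffices: only its independence of `z` matters for the strip argument. -/
lemma norm_powVec_le [Fintype m] {x : m → ℝ} (hx : ∀ i, 0 ≤ x i) {z : ℂ} (hz : |z.re| ≤ 1) :
    ‖powVec x z‖ ≤ ∑ i, Real.exp |Real.log (x i)| := by
  rw [pi_norm_le_iff_of_nonneg (by positivity)]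
  intro i
  refine le_trans ?_ (Finset.single_le_sum (f := fun i => Real.exp |Real.log (x i)|)
    (fun i _ => (Real.exp_pos _).le) (Finset.mem_univ i))
  by_cases hi : x i = 0
  · simp [powVec, hi]
  · have hpos : 0 < x i := lt_of_le_of_ne (hx i) (Ne.symm hi)
    simp only [powVec, hi, if_false]
    rw [Complex.norm_cpow_eq_rpow_re_of_pos hpos, Real.rpow_def_of_pos hpos, Real.exp_le_exp]
    calc _ ≤ |Real.log (x i) * z.re| := le_abs_self _
      _ = |Real.log (x i)| * |z.re| := abs_mul _ _
      _ ≤ _ := mul_le_of_le_one_right (abs_nonneg _) hz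

lemma norm_powVec_le_one [Fintype m] {x : m → ℝ} (hx : ∀ i, 0 ≤ x i) {z : ℂ} (hz : z.re = 0) :
    ‖powVec x z‖ ≤ 1 := by
  rw [pi_norm_le_iff_of_nonneg zero_le_one]
  intro i
  by_cases hi : x i = 0
  · simp [powVec, hi]
  · have hpos : 0 < x i := lt_of_le_of_ne (hx i) (Ne.symm hi)
    simp only [powVec, hi, if_false]
    rw [Complex.norm_cpow_eq_rpow_re_of_pos hpos, hz, Real.rpow_zero]

lemma hasDerivAt_powVec (x : m → ℝ) (z : ℂ) :
    HasDerivAt (powVec x) (powVec x z * fun i => Complex.log (x i)) z := by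
  rw [hasDerivAt_pi]
  intro i
  by_cases hi : x i = 0
  · simpa [powVec, hi] using hasDerivAt_const z (0 : ℂ)
  · simpa [powVec, hi] using (hasDerivAt_id z).const_cpow (c := (x i : ℂ))
      (Or.inl (by exact_mod_cast hi))

end PowVec

/-! ### Functional calculus in an eigenbasis, entropy and fidelity -/

section Spectral

variable {m : Type*} [Fintype m] [DecidableEq m]

/-- The diagonal matrices in an eigenbasis of a Hermitian matrix, as a star homomorphism. -/
noncomputable def spec {M : Matrix m m ℂ} (h : M.IsHermitian) : (m → ℂ) →⋆ₐ[ℂ] Matrix m m ℂ :=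
  { ((Unitary.conjStarAlgAut ℂ _ h.eigenvectorUnitary).toAlgEquiv.toAlgHom.comp
      (Matrix.diagonalAlgHom ℂ : (m → ℂ) →ₐ[ℂ] Matrix m m ℂ)) with
    map_star' := fun d => by
      have : Matrix.diagonal (star d) = star (Matrix.diagonal d) := by
        rw [Matrix.star_eq_conjTranspose, Matrix.diagonal_conjTranspose]
      change Unitary.conjStarAlgAut ℂ _ h.eigenvectorUnitary (Matrix.diagonal (star d)) =
        star (Unitary.conjStarAlgAut ℂ _ h.eigenvectorUnitary (Matrix.diagonal d))
      rw [this, map_star] }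

lemma spec_apply {M : Matrix m m ℂ} (h : M.IsHermitian) (d : m → ℂ) :
    spec h d = (h.eigenvectorUnitary : Matrix m m ℂ) * Matrix.diagonal d *
      (h.eigenvectorUnitary : Matrix m m ℂ)ᴴ := rfl

lemma trace_spec {M : Matrix m m ℂ} (h : M.IsHermitian) (d : m → ℂ) :
    (spec h d).trace = ∑ i, d i := by
  rw [spec_apply, Matrix.trace_mul_comm, ← Matrix.mul_assoc, ← Matrix.star_eq_conjTranspose,
    Unitary.coe_star_mul_self, Matrix.one_mul, Matrix.trace_diagonal]

lemma spec_eigenvalues {M : Matrix m m ℂ} (h : M.IsHermitian) :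
    spec h (fun i => (h.eigenvalues i : ℂ)) = M := h.spectral_theorem.symm

lemma cfc_eq_spec {M : Matrix m m ℂ} (h : M.IsHermitian) (f : ℝ → ℝ) :
    cfc f M = spec h (fun i => (f (h.eigenvalues i) : ℂ)) := h.cfc_eq f

lemma cpow_eq_spec {M : Matrix m m ℂ} (h : M.IsHermitian) (z : ℂ) :
    cpow M z = spec h (powVec h.eigenvalues z) := by
  rw [cpow, dif_pos h, spec_apply]
  congr! with i

lemma cpow_mul_cpow {M : Matrix m m ℂ} (h : M.IsHermitian) (z w : ℂ) :
    cpow M z * cpow M w = cpow M (z + w) := by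
  rw [cpow_eq_spec h, cpow_eq_spec h, cpow_eq_spec h, ← map_mul, powVec_mul]

lemma conjTranspose_cpow {M : Matrix m m ℂ} (h : M.PosSemidef) (z : ℂ) :
    (cpow M z)ᴴ = cpow M (star z) := by
  rw [cpow_eq_spec h.1, cpow_eq_spec h.1, ← Matrix.star_eq_conjTranspose, ← map_star,
    star_powVec h.eigenvalues_nonneg]

lemma cpow_one {M : Matrix m m ℂ} (h : M.IsHermitian) : cpow M 1 = M := by
  rw [cpow_eq_spec h, powVec_one, spec_eigenvalues]

lemma cpow_half {M : Matrix m m ℂ} (h : M.PosSemidef) : cpow M (1 / 2) = cfc Real.sqrt M := by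
  rw [cpow_eq_spec h.1, powVec_half h.eigenvalues_nonneg, cfc_eq_spec h.1]

lemma entropy_eq_sum {M : Matrix m m ℂ} (h : M.IsHermitian) :
    entropy M = ∑ i, Real.negMulLog (h.eigenvalues i) := by
  rw [entropy, cfc_eq_spec h, trace_spec, ← Complex.ofReal_sum, Complex.ofReal_re]

/-- The right side depends on the characteristic polynomial alone, so it is the same for `Xᴴ * X`
and `X * Xᴴ`, and it is invariant under reindexing. -/
lemma trace_cfc_eq_roots {M : Matrix m m ℂ} (h : M.IsHermitian) (f : ℝ → ℝ) :
    (cfc f M).trace.re = (M.charpoly.roots.map fun z => f z.re).sum := by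
  rw [cfc_eq_spec h, trace_spec, ← Complex.ofReal_sum, Complex.ofReal_re,
    h.roots_charpoly_eq_eigenvalues, Multiset.map_map]
  rfl

lemma traceNorm_eq_trace_sqrt_mul_conjTranspose (X : Matrix m m ℂ) :
    traceNorm X = (cfc Real.sqrt (X * Xᴴ)).trace.re := by
  rw [traceNorm, trace_cfc_eq_roots (Matrix.isHermitian_conjTranspose_mul_self X),
    trace_cfc_eq_roots (Matrix.isHermitian_mul_conjTranspose_self X), Matrix.charpoly_mul_comm]

lemma conjTranspose_cfc_sqrt {M : Matrix m m ℂ} (h : M.PosSemidef) :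
    (cfc Real.sqrt M)ᴴ = cfc Real.sqrt M := by
  rw [← cpow_half h, conjTranspose_cpow h]
  norm_num

lemma cfc_sqrt_mul_self {M : Matrix m m ℂ} (h : M.PosSemidef) :
    cfc Real.sqrt M * cfc Real.sqrt M = M := by
  rw [← cpow_half h, cpow_mul_cpow h.1]
  norm_num [cpow_one h.1]

/-- With `σ = K Kᴴ`, `√ρ √σ (√ρ √σ)ᴴ = √ρ σ √ρ = (√ρ K)(√ρ K)ᴴ`; any factor `K` can therefore
replace `√σ`. -/
lemma fidelity_mul_conjTranspose {ρ : Matrix m m ℂ} (hρ : ρ.PosSemidef) (K : Matrix m m ℂ) :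
    fidelity ρ (K * Kᴴ) =
      (cfc Real.sqrt ((cpow ρ (1 / 2) * K) * (cpow ρ (1 / 2) * K)ᴴ)).trace.re := by
  have hσ := Matrix.posSemidef_self_mul_conjTranspose K
  rw [fidelity, traceNorm_eq_trace_sqrt_mul_conjTranspose, cpow_half hρ, Matrix.conjTranspose_mul,
    Matrix.conjTranspose_mul, conjTranspose_cfc_sqrt hσ, conjTranspose_cfc_sqrt hρ]
  congr 3
  calc _ = cfc Real.sqrt ρ * (cfc Real.sqrt (K * Kᴴ) * cfc Real.sqrt (K * Kᴴ)) *
        cfc Real.sqrt ρ := by simp only [Matrix.mul_assoc]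
    _ = _ := by rw [cfc_sqrt_mul_self hσ]; simp only [Matrix.mul_assoc]

lemma trace_cfc_sqrt_mul_self {ρ : Matrix m m ℂ} (hρ : ρ.PosSemidef) :
    (cfc Real.sqrt (ρ * ρ)).trace.re = ρ.trace.re := by
  have h2 : ρ * ρ = cfc (fun x : ℝ => x * x) ρ := by
    rw [cfc_eq_spec hρ.1]
    conv_lhs => rw [← spec_eigenvalues hρ.1, ← map_mul]
    congr 1; ext i; simp
  have h3 : cfc Real.sqrt (cfc (fun x : ℝ => x * x) ρ) = cfc (fun x : ℝ => √(x * x)) ρ := by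
    exact (cfc_comp' Real.sqrt (fun x : ℝ => x * x) ρ (by fun_prop) (by fun_prop) hρ.1).symm
  rw [h2, h3, cfc_eq_spec hρ.1]
  conv_rhs => rw [← spec_eigenvalues hρ.1]
  congr 3; ext i
  rw [Real.sqrt_mul_self (hρ.eigenvalues_nonneg i)]

end Spectral

/-! ### Trace norm duality -/

section TraceBound

open scoped Matrix.Norms.L2Operator

variable {m : Type*} [Fintype m] [DecidableEq m]

lemma sum_sq_col_le (Y : Matrix m m ℂ) (i : m) : ∑ k, ‖Y k i‖ ^ 2 ≤ ‖Y‖ ^ 2 := by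
  have h := Y.l2_opNorm_mulVec (EuclideanSpace.single i (1 : ℂ))
  rw [PiLp.norm_single, norm_one, mul_one, EuclideanSpace.norm_eq] at h
  have h2 := Real.sqrt_le_left (norm_nonneg Y) |>.1 h
  simpa using! h2

end TraceBound

/-- The variational bound for the trace norm, for a contraction `Y`. -/
lemma norm_trace_mul_le {m : Type*} [Fintype m] [DecidableEq m] (M Y : Matrix m m ℂ)
    (hY : ∀ i, ∀ U ∈ Matrix.unitaryGroup m ℂ, ∑ k, ‖(Y * U) k i‖ ^ 2 ≤ 1) :
    ‖(M * Y).trace‖ ≤ (cfc Real.sqrt (M * Mᴴ)).trace.re := by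
  have h := Matrix.isHermitian_mul_conjTranspose_self M
  set U : Matrix m m ℂ := (h.eigenvectorUnitary : Matrix m m ℂ) with hU
  have hUU : Uᴴ * U = 1 := Unitary.coe_star_mul_self h.eigenvectorUnitary
  have hUU' : U * Uᴴ = 1 := Unitary.coe_mul_star_self h.eigenvectorUnitary
  -- In an eigenbasis `U` of `M Mᴴ`, the rows of `Uᴴ M` have squared length equal to the
  -- eigenvalues. Cauchy–Schwarz against the columns of `Y U` then bounds each diagonal entry by a
  -- singular value of `M`.
  have hrow : ∀ i, ∑ k, ‖(Uᴴ * M) i k‖ ^ 2 = h.eigenvalues i := by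
    intro i
    have h1 : (Uᴴ * M) * (Uᴴ * M)ᴴ = Matrix.diagonal (fun i => (h.eigenvalues i : ℂ)) := by
      have h2 := spec_eigenvalues h
      rw [spec_apply, ← hU] at h2
      calc _ = Uᴴ * (M * Mᴴ) * U := by
            simp only [Matrix.conjTranspose_mul, Matrix.conjTranspose_conjTranspose,
              Matrix.mul_assoc]
        _ = Uᴴ * (U * Matrix.diagonal (fun i => (h.eigenvalues i : ℂ)) * Uᴴ) * U := by rw [h2]
        _ = (Uᴴ * U) * Matrix.diagonal (fun i => (h.eigenvalues i : ℂ)) * (Uᴴ * U) := by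
            simp only [Matrix.mul_assoc]
        _ = _ := by rw [hUU]; simp
    have h2 := congrFun (congrFun h1 i) i
    rw [Matrix.mul_apply, Matrix.diagonal_apply_eq] at h2
    simp only [Matrix.conjTranspose_apply, Complex.star_def, Complex.mul_conj,
      Complex.normSq_eq_norm_sq] at h2
    exact_mod_cast h2
  have htr : (M * Y).trace = ((Uᴴ * M) * (Y * U)).trace := by
    rw [Matrix.mul_assoc Uᴴ, Matrix.trace_mul_comm Uᴴ]
    simp only [Matrix.mul_assoc, hUU', Matrix.mul_one]
  rw [htr, Matrix.trace, cfc_eq_spec h, trace_spec, ← Complex.ofReal_sum, Complex.ofReal_re]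
  refine (norm_sum_le _ _).trans (Finset.sum_le_sum fun i _ => ?_)
  rw [Matrix.diag_apply, Matrix.mul_apply]
  calc _ ≤ ∑ k, ‖(Uᴴ * M) i k‖ * ‖(Y * U) k i‖ :=
        (norm_sum_le _ _).trans_eq (by simp only [norm_mul])
    _ ≤ √(∑ k, ‖(Uᴴ * M) i k‖ ^ 2) * √(∑ k, ‖(Y * U) k i‖ ^ 2) :=
        Real.sum_mul_le_sqrt_mul_sqrt _ _ _
    _ ≤ √(h.eigenvalues i) * 1 := by
        rw [hrow]
        gcongr
        exact Real.sqrt_le_one.2 (hY i U h.eigenvectorUnitary.2)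
    _ = _ := mul_one _

/-! ### Analytic families of operators and the fidelity bound -/

section Factor

open scoped Matrix.Norms.L2Operator

variable {n : Type*} [Fintype n] [DecidableEq n]

/-- An analytic family of operators, bounded on the strip `0 ≤ re z ≤ 1` and contractive on its left
edge, which at `0` fixes the state `ρ` and has derivative of expectation `l` there. -/
structure IsRecoveryFamily (ρ : Matrix n n ℂ) (G : ℂ → Matrix n n ℂ) (l : ℂ) : Prop where
  differentiable : Differentiable ℂ G
  bounded : ∃ K : ℝ, ∀ z : ℂ, 0 ≤ z.re → z.re ≤ 1 → ‖G z‖ ≤ K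
  contractive : ∀ z : ℂ, z.re = 0 → ‖G z‖ ≤ 1
  deriv_trace : ∃ D, HasDerivAt G D 0 ∧ (ρ * D).trace = l
  left : ρ * G 0 = ρ
  right : G 0 * ρ = ρ

lemma IsRecoveryFamily.mul {ρ : Matrix n n ℂ} {G H : ℂ → Matrix n n ℂ} {k l : ℂ}
    (hG : IsRecoveryFamily ρ G k) (hH : IsRecoveryFamily ρ H l) :
    IsRecoveryFamily ρ (fun z => G z * H z) (k + l) where
  differentiable := hG.differentiable.mul hH.differentiable
  bounded := by
    obtain ⟨K, hK⟩ := hG.bounded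
    obtain ⟨L, hL⟩ := hH.bounded
    refine ⟨K * L, fun z h0 h1 => (norm_mul_le _ _).trans ?_⟩
    have := hK z h0 h1
    have := hL z h0 h1
    have : 0 ≤ K := (norm_nonneg _).trans (hK z h0 h1)
    gcongr
  contractive := fun z hz => (norm_mul_le _ _).trans
    (mul_le_one₀ (hG.contractive z hz) (norm_nonneg _) (hH.contractive z hz))
  deriv_trace := by
    obtain ⟨D, hD, hDt⟩ := hG.deriv_trace
    obtain ⟨E, hE, hEt⟩ := hH.deriv_trace
    refine ⟨_, hD.mul hE, ?_⟩
    -- Product rule: `H 0` moves cyclically next to `ρ` and is absorbed, as is `G 0`, so the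
    -- derivatives of expectation add.
    rw [Matrix.mul_add, Matrix.trace_add, ← Matrix.mul_assoc, ← Matrix.mul_assoc, hG.left,
      Matrix.trace_mul_comm, ← Matrix.mul_assoc, hH.right, hDt, hEt]
  left := by rw [← Matrix.mul_assoc, hG.left, hH.left]
  right := by rw [Matrix.mul_assoc, hH.right, hG.right]

/-- With `ρ = Bᴴ B` and `P = 1 - Q`, the trace of `ρ P` is the squared Hilbert–Schmidt norm of `B
P`, hence `B P = 0`. -/
lemma eq_of_trace_mul_eq {ρ Q : Matrix n n ℂ} (hρ : ρ.PosSemidef) (hQ : Qᴴ = Q) (hQQ : Q * Q = Q)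
    (h : (ρ * Q).trace = ρ.trace) : ρ * Q = ρ ∧ Q * ρ = ρ := by
  obtain ⟨B, rfl⟩ : ∃ B : Matrix n n ℂ, ρ = Bᴴ * B := ⟨cpow ρ (1 / 2), by
    rw [conjTranspose_cpow hρ, cpow_mul_cpow hρ.1]; norm_num [cpow_one hρ.1]⟩
  set P := 1 - Q with hP
  have hPH : Pᴴ = P := by rw [hP, Matrix.conjTranspose_sub, hQ, Matrix.conjTranspose_one]
  have hPP : P * P = P := by
    rw [hP]; simp only [Matrix.mul_sub, Matrix.sub_mul, Matrix.mul_one, Matrix.one_mul, hQQ]; simp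
  have h0 : B * P = 0 := by
    rw [← Matrix.trace_conjTranspose_mul_self_eq_zero_iff, Matrix.conjTranspose_mul, hPH]
    rw [Matrix.mul_assoc, Matrix.trace_mul_comm, Matrix.mul_assoc, Matrix.mul_assoc, hPP,
      ← Matrix.mul_assoc, hP, Matrix.mul_sub, Matrix.trace_sub, h, Matrix.mul_one, sub_self]
  have h1 : Bᴴ * B * Q = Bᴴ * B := by
    have : B * Q = B := by
      rw [hP, Matrix.mul_sub, Matrix.mul_one, sub_eq_zero] at h0
      exact h0.symm
    rw [Matrix.mul_assoc, this]
  refine ⟨h1, ?_⟩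
  have h2 := congrArg Matrix.conjTranspose h1
  simpa [Matrix.conjTranspose_mul, hQ, Matrix.mul_assoc] using h2

variable {m : Type*} [Fintype m] [DecidableEq m]

/-- The powers of a marginal form a recovery family. -/
lemma isRecoveryFamily_cpow {ρ : Matrix n n ℂ} (hρ : ρ.PosSemidef) {M : Matrix m m ℂ}
    (hM : M.PosSemidef) (φ : Matrix m m ℂ →⋆ₐ[ℂ] Matrix n n ℂ)
    (hφ : ∀ X, (ρ * φ X).trace = (M * X).trace) {s : ℝ} (hs : |s| ≤ 1) :
    IsRecoveryFamily ρ (fun z => φ (cpow M (s * z))) (-s * entropy M) := by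
  set x := hM.1.eigenvalues with hx
  have hx0 : ∀ i, 0 ≤ x i := hM.eigenvalues_nonneg
  let Ψ : (m → ℂ) →⋆ₐ[ℂ] Matrix n n ℂ := φ.comp (spec hM.1)
  have hΨ : ∀ z, φ (cpow M z) = Ψ (powVec x z) := fun z => by
    rw [cpow_eq_spec hM.1]; rfl
  have hΨtr : ∀ d, (ρ * Ψ d).trace = ∑ i, x i * d i := fun d => by
    change (ρ * φ (spec hM.1 d)).trace = _
    rw [hφ]
    calc _ = (spec hM.1 (fun i => (x i : ℂ)) * spec hM.1 d).trace := by rw [hx, spec_eigenvalues]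
      _ = _ := by rw [← map_mul, trace_spec]; rfl
  have hder : ∀ z : ℂ, HasDerivAt (fun z => φ (cpow M (s * z)))
      (Ψ ((s : ℂ) • (powVec x (s * z) * fun i => Complex.log (x i)))) z := by
    intro z
    simp only [hΨ]
    have h1 := (hasDerivAt_powVec x (s * z)).scomp z ((hasDerivAt_id z).const_mul (s : ℂ))
    rw [mul_one] at h1
    exact ((LinearMap.toContinuousLinearMap
      (Ψ : (m → ℂ) →ₗ[ℂ] Matrix n n ℂ)).hasFDerivAt.comp_hasDerivAt z h1)
  -- Star homomorphisms are contractive, so operator bounds reduce to entrywise ones.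
  have hnorm : ∀ d, ‖Ψ d‖ ≤ ‖d‖ := fun d => NonUnitalStarAlgHom.norm_apply_le Ψ d
  -- `M ^ 0` is only the support projection of `M`. It fixes `ρ` because its expectation is the full
  -- trace; this is what covers states without full rank.
  have hfix : ρ * φ (cpow M (s * 0)) = ρ ∧ φ (cpow M (s * 0)) * ρ = ρ := by
    rw [mul_zero]
    refine eq_of_trace_mul_eq hρ ?_ ?_ ?_
    · rw [← Matrix.star_eq_conjTranspose, ← map_star, Matrix.star_eq_conjTranspose,
        conjTranspose_cpow hM, star_zero]
    · rw [← map_mul, cpow_mul_cpow hM.1, add_zero]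
    · rw [hφ]
      conv_lhs => enter [1, 1]; rw [← cpow_one hM.1]
      rw [cpow_mul_cpow hM.1, add_zero, cpow_one hM.1]
      simpa using (hφ 1).symm
  refine ⟨fun z => (hder z).differentiableAt,
    ⟨∑ i, Real.exp |Real.log (x i)|, fun z h0 h1 => ?_⟩, fun z hz => ?_,
    ⟨_, hder 0, ?_⟩, hfix.1, hfix.2⟩
  · rw [hΨ]
    refine (hnorm _).trans (norm_powVec_le hx0 ?_)
    rw [Complex.re_ofReal_mul, abs_mul, abs_of_nonneg h0]
    exact mul_le_one₀ hs h0 h1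
  · rw [hΨ]
    refine (hnorm _).trans (norm_powVec_le_one hx0 ?_)
    rw [Complex.re_ofReal_mul, hz, mul_zero]
  · rw [hΨtr, entropy_eq_sum hM.1, Complex.ofReal_sum, Finset.mul_sum]
    refine Finset.sum_congr rfl fun i _ => ?_
    by_cases hi : x i = 0
    · simp [hi, ← hx]
    · simp only [Pi.smul_apply, Pi.mul_apply, powVec, hi, mul_zero, if_false, Complex.cpow_zero,
        one_mul, smul_eq_mul, Real.negMulLog, ← hx, Complex.ofReal_mul, Complex.ofReal_neg,
        Complex.ofReal_log (hx0 i)]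
      ring

lemma norm_trace_mul_le_of_norm_le_one (M Y : Matrix n n ℂ) (hY : ‖Y‖ ≤ 1) :
    ‖(M * Y).trace‖ ≤ (cfc Real.sqrt (M * Mᴴ)).trace.re := by
  refine norm_trace_mul_le M Y fun i U hU => (sum_sq_col_le _ _).trans ?_
  rw [show ‖Y * U‖ = ‖Y‖ from CStarRing.norm_mul_mem_unitary Y hU]
  exact pow_le_one₀ (norm_nonneg _) hY

/-- A recovery family recovers `ρ`, up to the exponential of its derivative, at some point of
the right edge of the strip. -/
theorem IsRecoveryFamily.exists_fidelity {ρ : Matrix n n ℂ} (hρ : IsState ρ)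
    {V : ℂ → Matrix n n ℂ} {l : ℝ} (hV : IsRecoveryFamily ρ V l) :
    ∃ t : ℝ, Real.exp (l + entropy ρ / 2) ≤
      fidelity ρ (V (1 + t * Complex.I) * (V (1 + t * Complex.I))ᴴ) := by
  obtain ⟨hpos, htr⟩ := hρ
  -- The factor `ρ^(-z/2)`, whose derivative of expectation is `entropy ρ / 2`.
  have hR := isRecoveryFamily_cpow hpos hpos (StarAlgHom.id ℂ _) (fun X => rfl) (s := -(1 / 2))
    (by norm_num [abs_div])
  have hW := hR.mul hV
  set W : ℂ → Matrix n n ℂ :=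
    fun z => StarAlgHom.id ℂ _ (cpow ρ ((-(1 / 2) : ℝ) * z)) * V z with hWdef
  have hWz : ∀ z, W z = cpow ρ (-(1 / 2) * z) * V z := fun z => by
    simp only [hWdef]; push_cast; rfl
  let T : Matrix n n ℂ →L[ℂ] ℂ := LinearMap.toContinuousLinearMap
    ((Matrix.traceLinearMap n ℂ ℂ).comp (LinearMap.mulLeft ℂ ρ))
  have hT : ∀ X, T X = (ρ * X).trace := fun X => rfl
  obtain ⟨D, hD, hDt⟩ := hW.deriv_trace
  obtain ⟨K, hK⟩ := hW.bounded
  obtain ⟨t, ht⟩ := exists_exp_le_norm (f := fun z => T (W z)) (l := l + entropy ρ / 2)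
    (K := ‖T‖ * K) (T.differentiable.comp hW.differentiable)
    (fun z h0 h1 => (T.le_opNorm _).trans (by gcongr; exact hK z h0 h1))
    (fun z hz => by
      rw [hT]
      refine (norm_trace_mul_le_of_norm_le_one _ _ (hW.contractive z hz)).trans ?_
      rw [hpos.1, trace_cfc_sqrt_mul_self hpos, htr, Complex.one_re])
    (by rw [hT, hW.left, htr])
    (by
      have := T.hasFDerivAt.comp_hasDerivAt 0 hD
      rw [hT, hDt] at this
      convert! this using 1
      push_cast; ring)
  refine ⟨t, ht.trans ?_⟩
  set z : ℂ := 1 + t * Complex.I with hz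
  rw [fidelity_mul_conjTranspose hpos, hT, hWz]
  -- `ρ · ρ^(-z/2) = ρ^(-it/2) ρ^(1/2)`, and the imaginary power, a contraction, is moved cyclically
  -- to the right.
  have h1 : (ρ * (cpow ρ (-(1 / 2) * z) * V z)).trace =
      (cpow ρ (1 / 2) * V z * cpow ρ (-(t * Complex.I) / 2)).trace := by
    conv_lhs => enter [1, 1]; rw [← cpow_one hpos.1]
    rw [← Matrix.mul_assoc, cpow_mul_cpow hpos.1, Matrix.trace_mul_comm (_ * V z),
      ← Matrix.mul_assoc, cpow_mul_cpow hpos.1]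
    congr 3
    rw [hz]; ring
  rw [h1]
  refine norm_trace_mul_le_of_norm_le_one _ _ ?_
  have := hR.contractive (t * Complex.I) (by simp)
  convert this using 2
  push_cast
  change _ = cpow ρ _
  congr 1
  ring

end Factor

set_option linter.unusedSectionVars false

/-! ### Tensor embeddings and partial traces -/

section Embeddings

/-- The embedding `X ↦ X ⊗ 1`. -/
def ampRight {R : Type*} (S : Type*) [Fintype R] [DecidableEq R] [Fintype S] [DecidableEq S] :
    Matrix R R ℂ →⋆ₐ[ℂ] Matrix (R × S) (R × S) ℂ where
  toFun X := X ⊗ₖ (1 : Matrix S S ℂ)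
  map_one' := Matrix.one_kronecker_one
  map_mul' X Y := by rw [← Matrix.mul_kronecker_mul, Matrix.one_mul]
  map_zero' := Matrix.zero_kronecker _
  map_add' X Y := Matrix.add_kronecker X Y _
  commutes' c := by
    rw [Algebra.algebraMap_eq_smul_one, Matrix.smul_kronecker, Matrix.one_kronecker_one,
      Algebra.algebraMap_eq_smul_one]
  map_star' X := by
    rw [Matrix.star_eq_conjTranspose, Matrix.star_eq_conjTranspose, Matrix.conjTranspose_kronecker,
      Matrix.conjTranspose_one]

/-- The embedding `X ↦ 1 ⊗ X`. -/
def ampLeft (E : Type*) {R : Type*} [Fintype R] [DecidableEq R] [Fintype E] [DecidableEq E] :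
    Matrix R R ℂ →⋆ₐ[ℂ] Matrix (E × R) (E × R) ℂ where
  toFun X := (1 : Matrix E E ℂ) ⊗ₖ X
  map_one' := Matrix.one_kronecker_one
  map_mul' X Y := by rw [← Matrix.mul_kronecker_mul, Matrix.one_mul]
  map_zero' := Matrix.kronecker_zero _
  map_add' X Y := Matrix.kronecker_add _ X Y
  commutes' c := by
    rw [Algebra.algebraMap_eq_smul_one, Matrix.kronecker_smul, Matrix.one_kronecker_one,
      Algebra.algebraMap_eq_smul_one]
  map_star' X := by
    rw [Matrix.star_eq_conjTranspose, Matrix.star_eq_conjTranspose, Matrix.conjTranspose_kronecker,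
      Matrix.conjTranspose_one]

/-- Relabelling of a system. -/
def relabel {m n : Type*} [Fintype m] [DecidableEq m] [Fintype n] [DecidableEq n] (e : m ≃ n) :
    Matrix m m ℂ →⋆ₐ[ℂ] Matrix n n ℂ :=
  { (Matrix.reindexAlgEquiv ℂ ℂ e).toAlgHom with
    map_star' := fun X => (Matrix.conjTranspose_reindex e e X).symm }

variable {X Y Z : Type*} [Fintype X] [Fintype Y] [Fintype Z] [DecidableEq X] [DecidableEq Y]
  [DecidableEq Z]

lemma ampRight_apply (M : Matrix X X ℂ) (p q : X × Y) :
    ampRight Y M p q = M p.1 q.1 * (1 : Matrix Y Y ℂ) p.2 q.2 := rfl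

lemma ampLeft_apply (M : Matrix Y Y ℂ) (p q : X × Y) :
    ampLeft X M p q = (1 : Matrix X X ℂ) p.1 q.1 * M p.2 q.2 := rfl

lemma ungroup_apply (M : Matrix ((X × Y) × Z) ((X × Y) × Z) ℂ) (p q : X × Y × Z) :
    ungroup M p q = M ((p.1, p.2.1), p.2.2) ((q.1, q.2.1), q.2.2) := rfl

lemma regroup_apply (M : Matrix (X × Y × Z) (X × Y × Z) ℂ) (p q : (X × Y) × Z) :
    regroup M p q = M (p.1.1, p.1.2, p.2) (q.1.1, q.1.2, q.2) := rfl

lemma trace_mul_ampRight (ρ : Matrix (X × Y) (X × Y) ℂ) (M : Matrix X X ℂ) :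
    (ρ * ampRight Y M).trace = (traceRight ρ * M).trace := by
  simp only [Matrix.trace, Matrix.diag_apply, Matrix.mul_apply, ampRight_apply,
    Fintype.sum_prod_type, traceRight, Matrix.of_apply, Matrix.one_apply, mul_ite, mul_one,
    mul_zero, Finset.sum_ite_eq', Finset.mem_univ, if_true, Finset.sum_mul]
  exact Finset.sum_congr rfl fun i _ => Finset.sum_comm

lemma trace_mul_ampLeft (ρ : Matrix (X × Y) (X × Y) ℂ) (M : Matrix Y Y ℂ) :
    (ρ * ampLeft X M).trace = (traceLeft ρ * M).trace := by
  simp only [Matrix.trace, Matrix.diag_apply, Matrix.mul_apply, ampLeft_apply,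
    Fintype.sum_prod_type_right, traceLeft, Matrix.of_apply, Matrix.one_apply, ite_mul, one_mul,
    mul_ite, zero_mul, mul_zero, Finset.sum_ite_eq', Finset.mem_univ, if_true, Finset.sum_mul]
  exact Finset.sum_congr rfl fun i _ => Finset.sum_comm

lemma trace_mul_ungroup (ρ : Matrix (X × Y × Z) (X × Y × Z) ℂ)
    (M : Matrix ((X × Y) × Z) ((X × Y) × Z) ℂ) :
    (ρ * ungroup M).trace = (regroup ρ * M).trace := by
  simp only [Matrix.trace, Matrix.diag_apply, Matrix.mul_apply, ungroup_apply, regroup_apply,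
    Fintype.sum_prod_type]

lemma posSemidef_traceRight {ρ : Matrix (X × Y) (X × Y) ℂ} (h : ρ.PosSemidef) :
    (traceRight ρ).PosSemidef := by
  have : traceRight ρ = ∑ k, ρ.submatrix (fun i => (i, k)) (fun i => (i, k)) := by
    ext i j; simp [traceRight, Matrix.sum_apply]
  rw [this]
  exact Matrix.posSemidef_sum _ fun k _ => h.submatrix _

lemma posSemidef_traceLeft {ρ : Matrix (X × Y) (X × Y) ℂ} (h : ρ.PosSemidef) :
    (traceLeft ρ).PosSemidef := by
  have : traceLeft ρ = ∑ k, ρ.submatrix (fun i => (k, i)) (fun i => (k, i)) := by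
    ext i j; simp [traceLeft, Matrix.sum_apply]
  rw [this]
  exact Matrix.posSemidef_sum _ fun k _ => h.submatrix _

lemma posSemidef_regroup {ρ : Matrix (X × Y × Z) (X × Y × Z) ℂ} (h : ρ.PosSemidef) :
    (regroup ρ).PosSemidef := h.submatrix _

lemma entropy_reindex {M : Matrix X X ℂ} (h : M.IsHermitian) (e : X ≃ Y) :
    entropy (M.reindex e e) = entropy M := by
  have h2 : (M.reindex e e).IsHermitian := h.submatrix _
  rw [entropy, entropy, trace_cfc_eq_roots h, trace_cfc_eq_roots h2, Matrix.charpoly_reindex]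

lemma ampLeft_mul_mul_apply (L L' : Matrix Y Y ℂ) (M : Matrix (X × Y) (X × Y) ℂ) (p q : X × Y) :
    (ampLeft X L * M * ampLeft X L') p q =
      (L * Matrix.of (fun r s => M (p.1, r) (q.1, s)) * L') p.2 q.2 := by
  simp only [Matrix.mul_apply, ampLeft_apply, Fintype.sum_prod_type_right, Matrix.of_apply,
    Matrix.one_apply, ite_mul, one_mul, mul_ite, zero_mul, mul_zero, Finset.sum_ite_eq',
    Finset.sum_ite_eq, Finset.mem_univ, if_true]

/-- Multiplication by `1 ⊗ L` acts on each block separately, so the blockwise `id ⊗ Φ` becomes a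
product of amplified operators. -/
lemma idTensor_twirledPetz (ρ : Matrix (Y × Z) (Y × Z) ℂ) (t : ℝ)
    (M : Matrix (X × Y) (X × Y) ℂ) :
    idTensor (twirledPetz ρ t) M =
      ampLeft X (cpow ρ (1 / 2 - Complex.I * t / 2)) *
        ungroup (ampRight Z (ampLeft X (cpow (traceRight ρ) (-1 / 2 + Complex.I * t / 2)) * M *
          ampLeft X (cpow (traceRight ρ) (-1 / 2 - Complex.I * t / 2)))) *
        ampLeft X (cpow ρ (1 / 2 + Complex.I * t / 2)) := by
  ext p q
  rw [ampLeft_mul_mul_apply, idTensor, Matrix.of_apply, twirledPetz]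
  refine congrArg (fun X : Matrix (Y × Z) (Y × Z) ℂ => (cpow ρ (1 / 2 - Complex.I * t / 2) * X *
    cpow ρ (1 / 2 + Complex.I * t / 2)) p.2 q.2) ?_
  ext r s
  rw [Matrix.of_apply, ungroup_apply, ampRight_apply, ampLeft_mul_mul_apply]
  rfl

end Embeddings

/-! ### The two-step recovery on four systems -/

section FourPartite

variable {A B C D : Type*} [Fintype A] [Fintype B] [Fintype C] [Fintype D]
  [DecidableEq A] [DecidableEq B] [DecidableEq C] [DecidableEq D]

/-- The embedding of the operators on `AB`. -/
def embAB : Matrix (A × B) (A × B) ℂ →⋆ₐ[ℂ] Matrix (A × B × C × D) (A × B × C × D) ℂ :=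
  (relabel (Equiv.prodAssoc A B (C × D))).comp (ampRight (C × D))

/-- The embedding of the operators on `BC`. -/
def embBC : Matrix (B × C) (B × C) ℂ →⋆ₐ[ℂ] Matrix (A × B × C × D) (A × B × C × D) ℂ :=
  (ampLeft A).comp ((relabel (Equiv.prodAssoc B C D)).comp (ampRight D))

/-- The embedding of the operators on `CD`. -/
def embCD : Matrix (C × D) (C × D) ℂ →⋆ₐ[ℂ] Matrix (A × B × C × D) (A × B × C × D) ℂ :=
  (ampLeft A).comp (ampLeft B)

/-- The embedding of the operators on `B`. -/
def embB : Matrix B B ℂ →⋆ₐ[ℂ] Matrix (A × B × C × D) (A × B × C × D) ℂ :=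
  embBC.comp (ampRight C)

/-- The embedding of the operators on `C`. -/
def embC : Matrix C C ℂ →⋆ₐ[ℂ] Matrix (A × B × C × D) (A × B × C × D) ℂ :=
  embCD.comp (ampRight D)

/-- The embedding of the operators on `ABC`. -/
def embABC : Matrix (A × B × C) (A × B × C) ℂ →⋆ₐ[ℂ] Matrix (A × B × C × D) (A × B × C × D) ℂ :=
  (relabel (Equiv.prodAssoc A B (C × D))).comp ((relabel (Equiv.prodAssoc (A × B) C D)).comp
    ((ampRight D).comp (relabel (Equiv.prodAssoc A B C).symm)))

/-- The marginal is dual to the embedding. This and its analogues supply the trace hypothesis of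
`isRecoveryFamily_cpow`. -/
lemma trace_mul_embAB (ρ : Matrix (A × B × C × D) (A × B × C × D) ℂ) (M : Matrix (A × B) (A × B) ℂ) :
    (ρ * embAB M).trace = (margAB ρ * M).trace := by
  change (ρ * ungroup (ampRight (C × D) M)).trace = _
  rw [trace_mul_ungroup, trace_mul_ampRight, margAB]

lemma trace_mul_embBC (ρ : Matrix (A × B × C × D) (A × B × C × D) ℂ) (M : Matrix (B × C) (B × C) ℂ) :
    (ρ * embBC M).trace = (margBC ρ * M).trace := by
  change (ρ * ampLeft A (ungroup (ampRight D M))).trace = _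
  rw [trace_mul_ampLeft, trace_mul_ungroup, trace_mul_ampRight, margBC]

lemma trace_mul_embCD (ρ : Matrix (A × B × C × D) (A × B × C × D) ℂ) (M : Matrix (C × D) (C × D) ℂ) :
    (ρ * embCD M).trace = (margCD ρ * M).trace := by
  change (ρ * ampLeft A (ampLeft B M)).trace = _
  rw [trace_mul_ampLeft, trace_mul_ampLeft, margCD]

lemma trace_mul_embB (ρ : Matrix (A × B × C × D) (A × B × C × D) ℂ) (M : Matrix B B ℂ) :
    (ρ * embB M).trace = (traceRight (margBC ρ) * M).trace := by
  change (ρ * embBC (ampRight C M)).trace = _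
  rw [trace_mul_embBC, trace_mul_ampRight]

lemma trace_mul_embC (ρ : Matrix (A × B × C × D) (A × B × C × D) ℂ) (M : Matrix C C ℂ) :
    (ρ * embC M).trace = (traceRight (margCD ρ) * M).trace := by
  change (ρ * embCD (ampRight D M)).trace = _
  rw [trace_mul_embCD, trace_mul_ampRight]

lemma one_prod_apply {X Y : Type*} [DecidableEq X] [DecidableEq Y] (p q : X × Y) :
    (1 : Matrix (X × Y) (X × Y) ℂ) p q =
      (1 : Matrix X X ℂ) p.1 q.1 * (1 : Matrix Y Y ℂ) p.2 q.2 := by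
  rw [← Matrix.one_kronecker_one]; rfl

lemma ungroup_ampLeft_prod (M : Matrix (C × D) (C × D) ℂ) :
    ungroup (ampLeft (A × B) M) = embCD M := by
  ext p q
  change (1 : Matrix (A × B) (A × B) ℂ) (p.1, p.2.1) (q.1, q.2.1) * _ = _ * (_ * _)
  rw [one_prod_apply, mul_assoc]
  rfl

lemma ungroup_ungroup_ampRight_ampLeft (M : Matrix C C ℂ) :
    ungroup (ungroup (ampRight D (ampLeft (A × B) M))) = embC M := by
  ext p q
  change ((1 : Matrix (A × B) (A × B) ℂ) (p.1, p.2.1) (q.1, q.2.1) * _) * _ = _ * (_ * (_ * _))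
  rw [one_prod_apply, mul_assoc, mul_assoc]
  rfl

lemma embABC_ampLeft (M : Matrix (B × C) (B × C) ℂ) :
    embABC (ampLeft A M) = embBC (D := D) M := by
  ext p q
  change ((_ : ℂ) * _) * _ = _ * (_ * _)
  rw [mul_assoc]
  rfl

lemma embABC_ungroup_ampRight (M : Matrix (A × B) (A × B) ℂ) :
    embABC (ungroup (ampRight C M)) = embAB (D := D) M := by
  ext p q
  change (_ * (1 : Matrix C C ℂ) p.2.2.1 q.2.2.1) * (1 : Matrix D D ℂ) p.2.2.2 q.2.2.2 =
    _ * (1 : Matrix (C × D) (C × D) ℂ) p.2.2 q.2.2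
  rw [one_prod_apply, mul_assoc]
  rfl

/-- `embB` passes through `BC`; the first Petz step also meets `B` inside `AB`, so the two routes
must agree. -/
lemma embAB_ampLeft (M : Matrix B B ℂ) : embAB (ampLeft A M) = embB (C := C) (D := D) M := by
  rw [← embABC_ungroup_ampRight, embB, StarAlgHom.comp_apply, ← embABC_ampLeft]
  congr 1
  ext p q
  change ((_ : ℂ) * _) * _ = _ * (_ * _)
  rw [mul_assoc]
  rfl

/-- The operator `K` with `K Kᴴ` the recovered operator. -/
noncomputable def recoveryOp (ρ : Matrix (A × B × C × D) (A × B × C × D) ℂ) (z : ℂ) :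
    Matrix (A × B × C × D) (A × B × C × D) ℂ :=
  embCD (cpow (margCD ρ) ((1 / 2 : ℝ) * z)) *
    embC (cpow (traceRight (margCD ρ)) ((-(1 / 2) : ℝ) * z)) *
    embBC (cpow (margBC ρ) ((1 / 2 : ℝ) * z)) *
    embB (cpow (traceRight (margBC ρ)) ((-(1 / 2) : ℝ) * z)) *
    embAB (cpow (margAB ρ) ((1 / 2 : ℝ) * z))

lemma ungroup_mul {X Y Z : Type*} [Fintype X] [Fintype Y] [Fintype Z] [DecidableEq X]
    [DecidableEq Y] [DecidableEq Z] (M N : Matrix ((X × Y) × Z) ((X × Y) × Z) ℂ) :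
    ungroup (M * N) = ungroup M * ungroup N := map_mul (relabel (Equiv.prodAssoc X Y Z)) M N

lemma ungroup_idTensor_twirledPetz (ρ : Matrix (C × D) (C × D) ℂ) (t : ℝ)
    (M : Matrix (A × B × C) (A × B × C) ℂ) :
    ungroup (idTensor (twirledPetz ρ t) (regroup M)) =
      embCD (cpow ρ (1 / 2 - Complex.I * t / 2)) *
        (embC (cpow (traceRight ρ) (-1 / 2 + Complex.I * t / 2)) * embABC M *
          embC (cpow (traceRight ρ) (-1 / 2 - Complex.I * t / 2))) *
        embCD (cpow ρ (1 / 2 + Complex.I * t / 2)) := by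
  rw [idTensor_twirledPetz]
  simp only [map_mul, ungroup_mul, ungroup_ampLeft_prod, ungroup_ungroup_ampRight_ampLeft]
  rfl

lemma embABC_idTensor_twirledPetz (ρ : Matrix (B × C) (B × C) ℂ) (t : ℝ)
    (M : Matrix (A × B) (A × B) ℂ) :
    embABC (D := D) (idTensor (twirledPetz ρ t) M) =
      embBC (cpow ρ (1 / 2 - Complex.I * t / 2)) *
        (embB (cpow (traceRight ρ) (-1 / 2 + Complex.I * t / 2)) * embAB M *
          embB (cpow (traceRight ρ) (-1 / 2 - Complex.I * t / 2))) *
        embBC (cpow ρ (1 / 2 + Complex.I * t / 2)) := by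
  rw [idTensor_twirledPetz]
  simp only [map_mul, ungroup_mul, embABC_ampLeft, embABC_ungroup_ampRight, embAB_ampLeft]

lemma posSemidef_margAB {ρ : Matrix (A × B × C × D) (A × B × C × D) ℂ} (h : ρ.PosSemidef) :
    (margAB ρ).PosSemidef := posSemidef_traceRight (posSemidef_regroup h)

lemma posSemidef_margBC {ρ : Matrix (A × B × C × D) (A × B × C × D) ℂ} (h : ρ.PosSemidef) :
    (margBC ρ).PosSemidef := posSemidef_traceRight (posSemidef_regroup (posSemidef_traceLeft h))

lemma posSemidef_margCD {ρ : Matrix (A × B × C × D) (A × B × C × D) ℂ} (h : ρ.PosSemidef) :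
    (margCD ρ).PosSemidef := posSemidef_traceLeft (posSemidef_traceLeft h)

lemma conjTranspose_map_cpow {m n : Type*} [Fintype m] [DecidableEq m] [Fintype n] [DecidableEq n]
    (φ : Matrix m m ℂ →⋆ₐ[ℂ] Matrix n n ℂ) {M : Matrix m m ℂ} (h : M.PosSemidef) (z : ℂ) :
    (φ (cpow M z))ᴴ = φ (cpow M (star z)) := by
  rw [← Matrix.star_eq_conjTranspose, ← map_star, Matrix.star_eq_conjTranspose, conjTranspose_cpow h]

/-- The exponent `1/2 - iλ/2` equals `z/2` at `z = 1 + it` exactly when `λ = -t`. Using one `λ` in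
both steps lets a single analytic variable drive all factors. -/
lemma recovered_eq {ρ : Matrix (A × B × C × D) (A × B × C × D) ℂ} (h : ρ.PosSemidef) (t : ℝ) :
    recovered ρ (-t) = recoveryOp ρ (1 + t * Complex.I) * (recoveryOp ρ (1 + t * Complex.I))ᴴ := by
  have e1 : ((1 / 2 : ℝ) : ℂ) * (1 + t * Complex.I) = 1 / 2 - Complex.I * (-t : ℝ) / 2 := by
    push_cast; ring
  have e2 : ((-(1 / 2) : ℝ) : ℂ) * (1 + t * Complex.I) = -1 / 2 + Complex.I * (-t : ℝ) / 2 := by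
    push_cast; ring
  have e3 : star (1 / 2 - Complex.I * (-t : ℝ) / 2) = 1 / 2 + Complex.I * (-t : ℝ) / 2 := by
    simp [neg_div]
  have e4 : star (-1 / 2 + Complex.I * (-t : ℝ) / 2) = -1 / 2 - Complex.I * (-t : ℝ) / 2 := by
    simp [neg_div]
  -- Splitting the input as `ρ_AB^(z/2) (ρ_AB^(z/2))ᴴ` exhibits the whole output as `K Kᴴ`.
  have hAB : embAB (C := C) (D := D) (margAB ρ) =
      embAB (cpow (margAB ρ) (1 / 2 - Complex.I * (-t : ℝ) / 2)) *
        embAB (cpow (margAB ρ) (1 / 2 + Complex.I * (-t : ℝ) / 2)) := by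
    rw [← map_mul, cpow_mul_cpow (posSemidef_margAB h).1]
    ring_nf
    rw [cpow_one (posSemidef_margAB h).1]
  rw [recovered, ungroup_idTensor_twirledPetz, embABC_idTensor_twirledPetz, recoveryOp, e1, e2]
  simp only [Matrix.conjTranspose_mul, conjTranspose_map_cpow _ (posSemidef_margAB h),
    conjTranspose_map_cpow _ (posSemidef_margBC h), conjTranspose_map_cpow _ (posSemidef_margCD h),
    conjTranspose_map_cpow _ (posSemidef_traceRight (posSemidef_margBC h)),
    conjTranspose_map_cpow _ (posSemidef_traceRight (posSemidef_margCD h)), e3, e4, hAB,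
    Matrix.mul_assoc]

lemma isRecoveryFamily_recoveryOp {ρ : Matrix (A × B × C × D) (A × B × C × D) ℂ}
    (h : ρ.PosSemidef) :
    IsRecoveryFamily ρ (recoveryOp ρ)
      ((-(1 / 2) * (entropy (margAB ρ) + entropy (margBC ρ) + entropy (margCD ρ)
        - entropy (traceRight (margBC ρ)) - entropy (traceRight (margCD ρ))) : ℝ) : ℂ) := by
  have s1 : |(1 / 2 : ℝ)| ≤ 1 := by norm_num [abs_div]
  have s2 : |(-(1 / 2) : ℝ)| ≤ 1 := by norm_num [abs_div]
  have hC := posSemidef_traceRight (posSemidef_margCD h)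
  have hB := posSemidef_traceRight (posSemidef_margBC h)
  have := ((((isRecoveryFamily_cpow h (posSemidef_margCD h) embCD (trace_mul_embCD ρ) s1).mul
    (isRecoveryFamily_cpow h hC embC (trace_mul_embC ρ) s2)).mul
    (isRecoveryFamily_cpow h (posSemidef_margBC h) embBC (trace_mul_embBC ρ) s1)).mul
    (isRecoveryFamily_cpow h hB embB (trace_mul_embB ρ) s2)).mul
    (isRecoveryFamily_cpow h (posSemidef_margAB h) embAB (trace_mul_embAB ρ) s1)
  convert! this using 1
  push_cast
  ring

lemma traceRight_regroup_margABC (ρ : Matrix (A × B × C × D) (A × B × C × D) ℂ) :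
    traceRight (regroup (margABC ρ)) = margAB ρ := by
  ext i j
  simp only [traceRight, margABC, margAB, Matrix.of_apply, Fintype.sum_prod_type]
  rfl

lemma traceLeft_margABC (ρ : Matrix (A × B × C × D) (A × B × C × D) ℂ) :
    traceLeft (margABC ρ) = margBC ρ := by
  ext i j
  simp only [traceRight, traceLeft, margABC, margBC, Matrix.of_apply]
  exact Finset.sum_comm

/-- The entropies of `ABC` and `BCD` cancel, and so does one of the two copies of that of `BC`. -/
lemma sum_condMutualInfo {ρ : Matrix (A × B × C × D) (A × B × C × D) ℂ} (h : ρ.PosSemidef) :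
    condMutualInfo (margABC ρ) + condMutualInfo (margBCD ρ) + condMutualInfo (groupBC ρ) =
      entropy (margAB ρ) + entropy (margBC ρ) + entropy (margCD ρ)
        - entropy (traceRight (margBC ρ)) - entropy (traceRight (margCD ρ)) - entropy ρ := by
  have h1 : entropy (groupBC ρ) = entropy ρ := entropy_reindex h.1 _
  have h2 : entropy (traceLeft (groupBC ρ)) = entropy (margBCD ρ) :=
    entropy_reindex (posSemidef_traceLeft h).1 (Equiv.prodAssoc B C D).symm
  have h3 : traceRight (traceLeft (groupBC ρ)) = margBC ρ := rfl
  have h4 : traceRight (regroup (groupBC ρ)) = margABC ρ := rfl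
  have h5 : traceRight (regroup (margBCD ρ)) = margBC ρ := rfl
  have h6 : traceLeft (margBCD ρ) = margCD ρ := rfl
  simp only [condMutualInfo, h1, h2, h3, h4, h5, h6, traceRight_regroup_margABC, traceLeft_margABC]
  ring

end FourPartite

end QRecovery

theorem mainTheorem1 {A B C D : Type*} [Fintype A] [Fintype B] [Fintype C] [Fintype D]
    [DecidableEq A] [DecidableEq B] [DecidableEq C] [DecidableEq D]
    (ρ : Matrix (A × B × C × D) (A × B × C × D) ℂ) (hρ : QRecovery.IsState ρ) :
    ∃ t : ℝ,
      Real.exp (-(1 / 2) *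
          (QRecovery.condMutualInfo (QRecovery.margABC ρ)
            + QRecovery.condMutualInfo (QRecovery.margBCD ρ)
            + QRecovery.condMutualInfo (QRecovery.groupBC ρ)))
        ≤ QRecovery.fidelity ρ (QRecovery.recovered ρ t) := by
  obtain ⟨t, ht⟩ := (QRecovery.isRecoveryFamily_recoveryOp hρ.1).exists_fidelity hρ
  refine ⟨-t, ?_⟩
  rw [QRecovery.sum_condMutualInfo hρ.1, QRecovery.recovered_eq hρ.1]
  convert! ht using 2
  ring
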